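/- **Definitions.** Let $d\ge 2$ and let $\|\cdot\|$ be the Euclidean norm. A finite set $A\subset\mathbb Z^d$ is called connected if the subgraph it induces in the nearest neighbour graph on $\mathbb Z^d$ (edges $\{x,y\}$ with $\|x-y\|=1$) is connected; if $0\in A$, its radius is $\mathrm{rad}(A):=\max_{x\in A}\|x\|$. For $z\in\mathbb Z^d$ let $C_z:=z+[-\tfrac12,\tfrac12]^d\subset\mathbb R^d$, and let $\square A:=\bigcup_{z\in A}C_z$. Let $A(d,1)$ be the space of lines in $\mathbb R^d$, with the $\sigma$-algebra generated by the sets $[K]:=\{L\in A(d,1): L\cap K\ne\emptyset\}$, $K\subset\mathbb R^d$ compact and convex. Let $\mu_1$ be the motion-invariant measure on $A(d,1)$, normalized so that $\mu_1([B_d])=\kappa_{d-1}$, where $B_d$ is the unit ball of $\mathbb R^d$ and $\kappa_{d-1}$ is the volume of the unit ball of $\mathbb R^{d-1}$; explicitly, $$\mu_1(\mathcal S)=\int_{\mathbb S^{d-1}}\lambda_{v^\perp}\big(\{x\in v^\perp: x+\mathbb R v\in\mathcal S\}\big)\,\sigma(dv),$$ where $\sigma$ is the uniform probability measure on the unit sphere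 and $\lambda_{v^\perp}$ is Lebesgue measure on the hyperplane $v^\perp$. For a compact set $K$ with $\mu_1([K])>0$ let $\mathbb P^{K}:=\mu_1(\,\cdot\,\cap[K])/\mu_1([K])$ be the distribution of an isotropic random line through $K$. Fix for each $L\in A(d,1)$ a unit direction vector $v_L$. For a finite non-empty $A\subset\mathbb Z^d$ let $L^A:=\{z\in A: C_z\cap L\neq\emptyset\}$, ordered by the position at which $L$, traversed in direction $v_L$, first visits $C_z$ (ties being decided by the lexicographic order of $\mathbb Z^d$), and let $\min(L^A)$ and $\max(L^A)$ be the first and the last element. Put $$b_A(z,L):=\begin{cases}1,& L^A=\{z\},\\ \tfrac12,& \#(L^A)>1\text{ and }z\in\{\min(L^A),\max(L^A)\},\\ 0,&\text{otherwise.}\end{cases}$$ The ballistic measure $b_A$ of $A$ is given by $b_A(z):=\int_{A(d,1)}b_A(z,L)\,\mathbb P^{\square A}(dL)$, $z\in\mathbb Z^d$. **Proposition.** For every integer $d\ge2$ there is a constant $C_d>0$ such that for every real $r\ge1$, every finite connected set $A\subset\mathbb Z^d$ with $0\in A$ and $\mathrm{rad}(A)\ge r$, and every $z\in A$, $$b_A(z)\le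 C_d\,r^{-1}.$$ For $d=2$ one may take $C_2=2$. -/

import Mathlib

open MeasureTheory ProbabilityTheory

noncomputable section

namespace Ballistic

/-- The Euclidean space `ℝ^d`. -/
abbrev E (d : ℕ) : Type := EuclideanSpace ℝ (Fin d)

/-- The lattice `ℤ^d`. -/
abbrev Lattice (d : ℕ) : Type := Fin d → ℤ

/-- The natural embedding of `ℤ^d` into `ℝ^d`. -/
def embed {d : ℕ} (z : Lattice d) : E d := WithLp.toLp 2 (fun i => (z i : ℝ))

/-- The nearest neighbour graph on `ℤ^d`: `x ~ y` iff the Euclidean distance of `x, y` is `1`. -/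
def latticeGraph (d : ℕ) : SimpleGraph (Lattice d) where
  Adj x y := ‖embed x - embed y‖ = 1
  symm := ⟨fun x y h => by rw [norm_sub_rev]; exact h⟩
  loopless := ⟨fun x h => by simp at h⟩

/-- `A` is connected as a subset of the nearest neighbour graph. -/
def IsConnectedSet {d : ℕ} (A : Finset (Lattice d)) : Prop :=
  ((latticeGraph d).induce (A : Set (Lattice d))).Connected

/-- `rad A = max_{x ∈ A} ‖x‖` (Euclidean norm); the value for `A = ∅` is `0`. -/
def rad {d : ℕ} (A : Finset (Lattice d)) : ℝ := (A.sup fun z => ‖embed z‖₊ : NNReal)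

/-- The space `A(d,1)` of lines in `ℝ^d`: the one-dimensional affine subspaces. -/
def Line (d : ℕ) : Type :=
  {L : AffineSubspace ℝ (E d) // Module.finrank ℝ L.direction = 1}

/-- The points of a line. -/
def Line.points {d : ℕ} (L : Line d) : Set (E d) := (L.1 : Set (E d))

/-- `[K]`, the set of lines which hit `K`. -/
def hit {d : ℕ} (K : Set (E d)) : Set (Line d) := {L | (L.points ∩ K).Nonempty}

/-- The `σ`-algebra on `A(d,1)`, generated by the sets `[K]`, where `K` is a convex body. -/
instance instMeasurableSpaceLine (d : ℕ) : MeasurableSpace (Line d) :=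
  MeasurableSpace.generateFrom {S | ∃ K : Set (E d), IsCompact K ∧ Convex ℝ K ∧ S = hit K}

/-- The unit sphere of `ℝ^d`. -/
abbrev Sphere (d : ℕ) : Type := Metric.sphere (0 : E d) 1

/-- The line through the point `x` with direction `v`. -/
def lineThrough {d : ℕ} (v : Sphere d) (x : E d) : Line d :=
  ⟨AffineSubspace.mk' x (Submodule.span ℝ {(v : E d)}), by
    rw [AffineSubspace.direction_mk']
    exact finrank_span_singleton (ne_zero_of_mem_unit_sphere v)⟩

lemma mem_lineThrough {d : ℕ} (v : Sphere d) (x y : E d) :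
    y ∈ (lineThrough v x).points ↔ ∃ t : ℝ, y = x + t • (v : E d) := by
  change y ∈ AffineSubspace.mk' x (Submodule.span ℝ {(v : E d)}) ↔ _
  rw [AffineSubspace.mem_mk', Submodule.mem_span_singleton]
  constructor
  · rintro ⟨t, ht⟩
    exact ⟨t, by rw [ht]; simp⟩
  · rintro ⟨t, rfl⟩
    exact ⟨t, by simp⟩

lemma lineThrough_add_smul {d : ℕ} (v : Sphere d) (x : E d) (t : ℝ) :
    lineThrough v (x + t • (v : E d)) = lineThrough v x := by
  apply Subtype.ext
  apply SetLike.coe_injective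
  change (lineThrough v _).points = (lineThrough v _).points
  ext y
  simp only [mem_lineThrough]
  constructor
  · rintro ⟨s, rfl⟩
    exact ⟨t + s, by module⟩
  · rintro ⟨s, rfl⟩
    exact ⟨s - t, by module⟩

lemma measurable_lineThrough (d : ℕ) :
    Measurable (fun p : Sphere d × E d => lineThrough p.1 p.2) := by
  apply measurable_generateFrom
  rintro S ⟨K, hK, -, rfl⟩
  apply IsClosed.measurableSet
  have : CompactSpace K := isCompact_iff_compactSpace.1 hK
  have h : IsClosed {q : (Sphere d × E d) × K | (q.2 : E d) - q.1.2
      = (inner ℝ (q.1.1 : E d) ((q.2 : E d) - q.1.2)) • (q.1.1 : E d)} :=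
    isClosed_eq (by fun_prop) (by fun_prop)
  convert isClosedMap_fst_of_compactSpace _ h using 1
  ext ⟨v, x⟩
  constructor
  · rintro ⟨y, hL, hy⟩
    obtain ⟨t, rfl⟩ := (mem_lineThrough v x y).1 hL
    refine ⟨((v, x), ⟨_, hy⟩), ?_, rfl⟩
    simp [inner_smul_right]
  · rintro ⟨⟨⟨v', x'⟩, ⟨y, hy⟩⟩, hp, he⟩
    obtain ⟨rfl, rfl⟩ := Prod.mk.inj he
    have hp' : y - x' = (inner ℝ (v' : E d) (y - x')) • (v' : E d) := hp
    exact ⟨y, (mem_lineThrough v' x' y).2 ⟨_, by rw [← hp']; abel⟩, hy⟩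

lemma volume_orthogonal_prod {d : ℕ} (U : Submodule ℝ (E d)) (P : Set U) (Q : Set Uᗮ)
    (T : Set (E d)) (hT : MeasurableSet T)
    (h : ∀ (a : U) (x : Uᗮ), (a : E d) + (x : E d) ∈ T ↔ a ∈ P ∧ x ∈ Q) :
    (volume : Measure (E d)) T = (volume : Measure U) P * (volume : Measure Uᗮ) Q := by
  have hmp := (U.orthogonalDecomposition.symm.measurePreserving).comp
    (WithLp.volume_preserving_toLp U Uᗮ)
  rw [← hmp.measure_preimage hT.nullMeasurableSet, ← Measure.prod_prod, ← Measure.volume_eq_prod]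
  congr 1
  ext ⟨a, x⟩
  exact h a x

lemma volume_unit_segment {d : ℕ} (v : Sphere d) :
    (volume : Measure (Submodule.span ℝ {(v : E d)}))
      {a | inner ℝ (v : E d) (a : E d) ∈ Set.Icc (0 : ℝ) 1} = 1 := by
  have hmem : (v : E d) ∈ Submodule.span ℝ {(v : E d)} := Submodule.mem_span_singleton_self _
  have hne : (⟨v, hmem⟩ : Submodule.span ℝ {(v : E d)}) ≠ 0 := fun h =>
    ne_zero_of_mem_unit_sphere v (congrArg Subtype.val h)
  have hn : ‖(⟨v, hmem⟩ : Submodule.span ℝ {(v : E d)})‖ₑ = 1 := by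
    rw [← ofReal_norm]
    simp
  have hm : Measurable fun a : Submodule.span ℝ {(v : E d)} => inner ℝ (v : E d) (a : E d) :=
    Continuous.measurable (by fun_prop)
  have hs : MeasurableSet {a : Submodule.span ℝ {(v : E d)} |
      inner ℝ (v : E d) (a : E d) ∈ Set.Icc (0 : ℝ) 1} := hm measurableSet_Icc
  rw [volume_eq_of_finrank_eq_one (finrank_span_singleton (ne_zero_of_mem_unit_sphere v)) hne, hn,
    one_smul, Measure.map_apply (by fun_prop) hs]
  have : (fun t : ℝ => t • (⟨v, hmem⟩ : Submodule.span ℝ {(v : E d)})) ⁻¹'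
      {a | inner ℝ (v : E d) (a : E d) ∈ Set.Icc (0 : ℝ) 1} = Set.Icc 0 1 := by
    ext t
    simp [inner_smul_right]
  rw [this, Real.volume_Icc]
  simp

lemma measurableSet_slab {d : ℕ} {S : Set (Line d)} (hS : MeasurableSet S) :
    MeasurableSet {p : Sphere d × E d | inner ℝ (p.1 : E d) p.2 ∈ Set.Icc (0 : ℝ) 1 ∧
      lineThrough p.1 p.2 ∈ S} := by
  have h : Measurable fun p : Sphere d × E d => inner ℝ (p.1 : E d) p.2 :=
    Continuous.measurable (by fun_prop)
  exact (h measurableSet_Icc).inter (measurable_lineThrough d hS)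

lemma volume_slab {d : ℕ} (v : Sphere d) {S : Set (Line d)} (hS : MeasurableSet S) :
    (volume : Measure (Submodule.span ℝ {(v : E d)})ᗮ) {x | lineThrough v (x : E d) ∈ S} =
      (volume : Measure (E d)) (Prod.mk v ⁻¹' {p : Sphere d × E d |
        inner ℝ (p.1 : E d) p.2 ∈ Set.Icc (0 : ℝ) 1 ∧ lineThrough p.1 p.2 ∈ S}) := by
  rw [volume_orthogonal_prod (Submodule.span ℝ {(v : E d)})
    {a | inner ℝ (v : E d) (a : E d) ∈ Set.Icc (0 : ℝ) 1} {x | lineThrough v (x : E d) ∈ S} _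
    (measurable_prodMk_left (measurableSet_slab hS)), volume_unit_segment, one_mul]
  intro a x
  have hx : inner ℝ (v : E d) (x : E d) = 0 :=
    Submodule.inner_right_of_mem_orthogonal (Submodule.mem_span_singleton_self _) x.2
  obtain ⟨t, ht⟩ := Submodule.mem_span_singleton.1 a.2
  have e : lineThrough v ((a : E d) + (x : E d)) = lineThrough v (x : E d) := by
    rw [← ht, add_comm, lineThrough_add_smul]
  change inner ℝ (v : E d) ((a : E d) + (x : E d)) ∈ Set.Icc (0 : ℝ) 1 ∧
    lineThrough v ((a : E d) + (x : E d)) ∈ S ↔ _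
  rw [e, inner_add_right, hx, add_zero]
  rfl

/-- For a direction `v`, the Lebesgue measure on the hyperplane `v^⊥`, transported to the lines
parallel to `v` by `x ↦ x + ℝ v`. -/
def parallelLines {d : ℕ} (v : Sphere d) : Measure (Line d) :=
  (volume : Measure (Submodule.span ℝ {(v : E d)})ᗮ).map
    (fun x : (Submodule.span ℝ {(v : E d)})ᗮ => lineThrough v (x : E d))

lemma parallelLines_apply {d : ℕ} (v : Sphere d) {S : Set (Line d)} (hS : MeasurableSet S) :
    parallelLines v S = (volume : Measure (Submodule.span ℝ {(v : E d)})ᗮ)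
      {x | lineThrough v (x : E d) ∈ S} := by
  have h0 : Measurable (fun x : E d => lineThrough v x) :=
    (measurable_lineThrough d).comp (g := fun p : Sphere d × E d => lineThrough p.1 p.2)
      (f := fun x : E d => (v, x)) measurable_prodMk_left
  have hme : Measurable
      (fun x : (Submodule.span ℝ {(v : E d)})ᗮ => lineThrough v (x : E d)) :=
    h0.comp measurable_subtype_coe
  rw [parallelLines, Measure.map_apply hme hS]
  rfl

/-- The measures `parallelLines v` depend measurably on `v`, so that they may be integrated. -/
lemma measurable_parallelLines (d : ℕ) :
    Measurable (parallelLines : Sphere d → Measure (Line d)) := by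
  refine Measure.measurable_of_measurable_coe _ fun S hS => ?_
  simp only [parallelLines_apply _ hS, volume_slab _ hS]
  exact measurable_measure_prodMk_left (measurableSet_slab hS)

/-- The uniform (rotation invariant) probability measure on the unit sphere. -/
def uniformSphere (d : ℕ) : Measure (Sphere d) :=
  ((volume : Measure (E d)).toSphere Set.univ)⁻¹ • (volume : Measure (E d)).toSphere

/-- The motion invariant measure `μ₁` on the space of lines: choose a uniform direction `v` and
then a line parallel to `v` according to the Lebesgue measure on `v^⊥`. As the orthogonal projection
of the unit ball to `v^⊥` is a unit ball, `μ₁ [B_d]` is the volume `κ_{d-1}` of the unit ball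
of `ℝ^{d-1}`. -/
def lineMeasure (d : ℕ) : Measure (Line d) := (uniformSphere d).bind parallelLines

/-- The grid box `C_z = [-1/2, 1/2]^d + z`. -/
def box {d : ℕ} (z : Lattice d) : Set (E d) :=
  {x | ∀ i, x i ∈ Set.Icc ((z i : ℝ) - 1 / 2) ((z i : ℝ) + 1 / 2)}

/-- `□A`, the union of the grid boxes centred in `A`. -/
def boxUnion {d : ℕ} (A : Finset (Lattice d)) : Set (E d) := ⋃ z ∈ A, box z

/-- The distribution `ℙ^K = μ₁(· ∩ [K]) / μ₁([K])` of an isotropic random line through `K`. -/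
def isotropicLine {d : ℕ} (K : Set (E d)) : Measure (Line d) := (lineMeasure d)[|hit K]

/-- A choice of a direction (unit vector) on each line. -/
def IsDirectionChoice {d : ℕ} (v : Line d → Sphere d) : Prop :=
  ∀ L : Line d, (v L : E d) ∈ L.1.direction

open Classical in
/-- `L^A`, the set of the points of `A` whose boxes are hit by `L`. -/
def hitPoints {d : ℕ} (A : Finset (Lattice d)) (L : Line d) : Finset (Lattice d) :=
  A.filter fun z => L ∈ hit (box z)

/-- The position at which `L`, traversed in direction `v`, first visits the box of `z`; positions
on `L` are measured by the coordinate `x ↦ ⟨v, x⟩`. -/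
def entry {d : ℕ} (v : Sphere d) (L : Line d) (z : Lattice d) : ℝ :=
  sInf ((fun x : E d => inner ℝ (v : E d) x) '' (L.points ∩ box z))

/-- The order in which the boxes are visited by `L`, traversed in direction `v`; ties are decided by
the lexicographic order of `ℤ^d`. -/
def VisitedBefore {d : ℕ} (v : Sphere d) (L : Line d) (z w : Lattice d) : Prop :=
  entry v L z < entry v L w ∨ (entry v L z = entry v L w ∧ toLex z ≤ toLex w)

/-- `z = min(L^A)`. -/
def IsFirst {d : ℕ} (v : Sphere d) (A : Finset (Lattice d)) (L : Line d) (z : Lattice d) : Prop :=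
  z ∈ hitPoints A L ∧ ∀ w ∈ hitPoints A L, VisitedBefore v L z w

/-- `z = max(L^A)`. -/
def IsLast {d : ℕ} (v : Sphere d) (A : Finset (Lattice d)) (L : Line d) (z : Lattice d) : Prop :=
  z ∈ hitPoints A L ∧ ∀ w ∈ hitPoints A L, VisitedBefore v L w z

open Classical in
/-- The function `b_A(z, L)`, for the directions `v` on the lines. -/
def ballisticWeight {d : ℕ} (v : Line d → Sphere d) (A : Finset (Lattice d)) (z : Lattice d)
    (L : Line d) : ENNReal :=
  if hitPoints A L = {z} then 1
  else if 1 < (hitPoints A L).card ∧ (IsFirst (v L) A L z ∨ IsLast (v L) A L z) then 1 / 2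
  else 0

/-- The mass `b_A(z) = ∫ b_A(z, L) ℙ^{□A}(dL)` of the ballistic measure of `A` at `z`. -/
def ballisticMass {d : ℕ} (v : Line d → Sphere d) (A : Finset (Lattice d)) (z : Lattice d) :
    ENNReal :=
  ∫⁻ L, ballisticWeight v A z L ∂(isotropicLine (boxUnion A))

end Ballistic

end

/-! The weight `b_A(z, L)` is at most 1 and vanishes unless `L` meets the box `C_z`, so `b_A(z)` is
at most `μ₁[C_z] / μ₁[□A]` (`ballisticMass_le`). By the definition of `μ₁`, the number `μ₁[K]` is
the average over directions `v` of the volume of the projection of `K` to `v^⊥` (`lineMeasure_hit`).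
The numerator is therefore bounded by a constant.

The denominator grows linearly in `r`. Take `x ∈ A` with `‖x‖ ≥ r`. Since `A` connects `0` to `x`,
the projection of `□A` has volume at least a constant times the length of the projection of `x`
(`enorm_proj_le_volume`). By rotation invariance this length has mean `‖x‖ m`, where `m > 0` is the
mean for a unit vector (`meanProj_eq`, `meanProj_stdVec_ne_zero`).

In the plane the shadow of `□A` contains the segment from `0` to the shadow of `x`, while the shadow
of a box is no longer than the shadows of its two sides together. The means are at least `r m` and
at most `2 m`, and the quotient is at most `2 / r`. -/

noncomputable section

namespace Ballistic

/-! ### Orthogonal projection along a direction. -/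

/-- The hyperplane `v^⊥`. -/
abbrev Perp {d : ℕ} (v : Sphere d) : Submodule ℝ (E d) := (Submodule.span ℝ {(v : E d)})ᗮ

/-- The orthogonal projection to the hyperplane `v^⊥`. -/
def proj {d : ℕ} (v : Sphere d) : E d →L[ℝ] Perp v := (Perp v).orthogonalProjectionOnto

lemma norm_sphere {d : ℕ} (v : Sphere d) : ‖(v : E d)‖ = 1 := by simp

lemma coe_proj {d : ℕ} (v : Sphere d) (x : E d) :
    (proj v x : E d) = x - inner ℝ (v : E d) x • (v : E d) := by
  have h := Submodule.starProjection_orthogonal_val (K := Submodule.span ℝ {(v : E d)}) x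
  rw [Submodule.starProjection_unit_singleton ℝ (norm_sphere v)] at h
  exact h

lemma norm_proj_le {d : ℕ} (v : Sphere d) (x : E d) : ‖proj v x‖ ≤ ‖x‖ :=
  Submodule.norm_orthogonalProjectionOnto_apply_le _ x

lemma inner_sphere_perp {d : ℕ} (v : Sphere d) (x : Perp v) : inner ℝ (v : E d) (x : E d) = 0 :=
  Submodule.inner_right_of_mem_orthogonal (Submodule.mem_span_singleton_self _) x.2

lemma norm_proj {d : ℕ} (v : Sphere d) (x : E d) :
    ‖proj v x‖ = ‖x - inner ℝ (v : E d) x • (v : E d)‖ := by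
  rw [← coe_proj, Submodule.coe_norm]

lemma norm_proj_sq {d : ℕ} (v : Sphere d) (x : E d) :
    ‖proj v x‖ ^ 2 = ‖x‖ ^ 2 - inner ℝ (v : E d) x ^ 2 := by
  rw [norm_proj, norm_sub_sq_real, inner_smul_right, norm_smul, norm_sphere,
    real_inner_comm, Real.norm_eq_abs, mul_one, sq_abs]
  ring

/-- The lines parallel to `v` which hit `K` correspond to the points of the projection of `K`. -/
lemma lineThrough_mem_hit_iff {d : ℕ} (v : Sphere d) (x : Perp v) (K : Set (E d)) :
    lineThrough v (x : E d) ∈ hit K ↔ x ∈ proj v '' K := by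
  constructor
  · rintro ⟨y, hy, hK⟩
    refine ⟨y, hK, ?_⟩
    obtain ⟨t, rfl⟩ := (mem_lineThrough v _ _).1 hy
    apply Subtype.ext
    rw [coe_proj, inner_add_right, inner_sphere_perp, inner_smul_right,
      real_inner_self_eq_norm_sq, norm_sphere]
    module
  · rintro ⟨y, hK, rfl⟩
    refine ⟨y, (mem_lineThrough v _ _).2 ⟨inner ℝ (v : E d) y, ?_⟩, hK⟩
    rw [coe_proj]
    module

/-! ### Grid boxes and measurability of the lines hitting them. -/

lemma norm_sub_embed_le {d : ℕ} {z : Lattice d} {x : E d} (hx : x ∈ box z) :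
    ‖x - embed z‖ ≤ √d / 2 := by
  have h : √d / 2 = √(d * (1 / 2) ^ 2) := by
    rw [Real.sqrt_mul (by positivity), Real.sqrt_sq (by norm_num)]
    ring
  rw [EuclideanSpace.norm_eq, h]
  refine Real.sqrt_le_sqrt ?_
  refine (Finset.sum_le_card_nsmul _ _ ((1 / 2) ^ 2) fun i _ => ?_).trans (by simp)
  have := hx i
  rw [Set.mem_Icc] at this
  rw [Real.norm_eq_abs, sq_abs, PiLp.sub_apply]
  have e : embed z i = (z i : ℝ) := rfl
  rw [e]
  nlinarith

lemma isCompact_box {d : ℕ} (z : Lattice d) : IsCompact (box z) := by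
  refine Metric.isCompact_of_isClosed_isBounded ?_
    ((Metric.isBounded_closedBall (x := embed z) (r := √d / 2)).subset fun x hx => ?_)
  · have : box z = ⋂ i, (fun x : E d => x i) ⁻¹'
        Set.Icc ((z i : ℝ) - 1 / 2) ((z i : ℝ) + 1 / 2) := by
      ext x
      simp [box]
    rw [this]
    exact isClosed_iInter fun i => isClosed_Icc.preimage (by fun_prop)
  · rw [Metric.mem_closedBall, dist_eq_norm]
    exact norm_sub_embed_le hx

lemma convex_box {d : ℕ} (z : Lattice d) : Convex ℝ (box z) := by
  intro x hx y hy a b ha hb hab i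
  exact (convex_Icc _ _) (hx i) (hy i) ha hb hab

lemma measurableSet_hit_box {d : ℕ} (z : Lattice d) : MeasurableSet (hit (box z)) :=
  MeasurableSpace.measurableSet_generateFrom ⟨box z, isCompact_box z, convex_box z, rfl⟩

lemma hit_boxUnion {d : ℕ} (A : Finset (Lattice d)) :
    hit (boxUnion A) = ⋃ z ∈ A, hit (box z) := by
  ext L
  simp only [hit, boxUnion, Set.mem_ofPred_eq, Set.inter_iUnion, Set.nonempty_iUnion,
    Set.mem_iUnion]

lemma measurableSet_hit_boxUnion {d : ℕ} (A : Finset (Lattice d)) :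
    MeasurableSet (hit (boxUnion A)) := by
  rw [hit_boxUnion]
  exact A.measurableSet_biUnion fun z _ => measurableSet_hit_box z

/-! ### Reduction to volumes of projections. -/

lemma lineMeasure_hit {d : ℕ} {K : Set (E d)} (hK : MeasurableSet (hit K)) :
    lineMeasure d (hit K) = ∫⁻ v, volume (proj v '' K) ∂uniformSphere d := by
  rw [lineMeasure, Measure.bind_apply hK (measurable_parallelLines d).aemeasurable]
  refine lintegral_congr fun v => ?_
  rw [parallelLines_apply v hK]
  congr 1
  ext x
  exact lineThrough_mem_hit_iff v x K

-- Only elements of `L^A` carry weight, so the order of visits plays no role in the bound.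
open Classical in
lemma ballisticWeight_le {d : ℕ} (v : Line d → Sphere d) (A : Finset (Lattice d)) (z : Lattice d)
    (L : Line d) : ballisticWeight v A z L ≤ (hit (box z)).indicator 1 L := by
  by_cases hL : L ∈ hit (box z)
  · rw [Set.indicator_of_mem hL, ballisticWeight]
    split_ifs
    · exact le_rfl
    · simp
    · simp
  · have h : z ∉ hitPoints A L := fun h => hL (Finset.mem_filter.1 h).2
    rw [ballisticWeight, if_neg, if_neg]
    · simp
    · rintro ⟨-, h' | h'⟩ <;> exact h h'.1
    · intro h'
      exact h (h' ▸ Finset.mem_singleton_self z)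

lemma ballisticMass_le {d : ℕ} (v : Line d → Sphere d) (A : Finset (Lattice d)) (z : Lattice d) :
    ballisticMass v A z ≤ lineMeasure d (hit (box z)) / lineMeasure d (hit (boxUnion A)) := by
  calc ballisticMass v A z
      ≤ ∫⁻ L, (hit (box z)).indicator 1 L ∂isotropicLine (boxUnion A) :=
        lintegral_mono (ballisticWeight_le v A z)
    _ = isotropicLine (boxUnion A) (hit (box z)) :=
        lintegral_indicator_one (measurableSet_hit_box z)
    _ ≤ _ := by
        rw [isotropicLine, cond_apply (measurableSet_hit_boxUnion A), mul_comm, ENNReal.div_eq_inv_mul,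
          mul_comm]
        gcongr
        exact Set.inter_subset_right

/-! ### Rotation invariance and the mean projected length. -/

/-- The action of a linear isometry on the unit sphere. -/
def sphereMap {d : ℕ} (U : E d ≃ₗᵢ[ℝ] E d) (v : Sphere d) : Sphere d :=
  ⟨U v, by simp⟩

lemma continuous_sphereMap {d : ℕ} (U : E d ≃ₗᵢ[ℝ] E d) : Continuous (sphereMap U) :=
  (U.continuous.comp continuous_subtype_val).subtype_mk _

-- The surface measure of `s` is, up to the factor `d`, the volume of the cone over `s`. Isometries
-- carry cones to cones and preserve volume.
open scoped Pointwise in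
lemma measurePreserving_sphereMap_toSphere {d : ℕ} (U : E d ≃ₗᵢ[ℝ] E d) :
    MeasurePreserving (sphereMap U) (volume : Measure (E d)).toSphere
      (volume : Measure (E d)).toSphere := by
  refine ⟨(continuous_sphereMap U).measurable, Measure.ext fun s hs => ?_⟩
  have hm := (continuous_sphereMap U).measurable
  rw [Measure.map_apply hm hs, Measure.toSphere_apply' _ hs, Measure.toSphere_apply' _ (hm hs)]
  congr 1
  have h : Set.Ioo (0 : ℝ) 1 • ((↑) '' (sphereMap U ⁻¹' s) : Set (E d)) =
      U ⁻¹' (Set.Ioo (0 : ℝ) 1 • ((↑) '' s)) := by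
    ext x
    simp only [Set.mem_smul, Set.mem_image, Set.mem_preimage]
    constructor
    · rintro ⟨t, ht, _, ⟨v, hv, rfl⟩, rfl⟩
      exact ⟨t, ht, _, ⟨_, hv, rfl⟩, by simp [sphereMap]⟩
    · rintro ⟨t, ht, _, ⟨w, hw, rfl⟩, hx⟩
      refine ⟨t, ht, _, ⟨sphereMap U.symm w, ?_, rfl⟩, ?_⟩
      · convert hw using 1
        exact Subtype.ext (U.apply_symm_apply _)
      · apply U.injective
        rw [← hx]
        simp [sphereMap]
  rw [h]
  exact (U.measurePreserving).measure_preimage_equiv (f := U.toMeasurableEquiv) _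

lemma measurePreserving_sphereMap {d : ℕ} (U : E d ≃ₗᵢ[ℝ] E d) :
    MeasurePreserving (sphereMap U) (uniformSphere d) (uniformSphere d) :=
  (measurePreserving_sphereMap_toSphere U).smul_measure _

lemma isProbabilityMeasure_uniformSphere {d : ℕ} (hd : 2 ≤ d) :
    IsProbabilityMeasure (uniformSphere d) := by
  have : Nonempty (Fin d) := ⟨⟨0, by omega⟩⟩
  refine ⟨?_⟩
  rw [uniformSphere, Measure.smul_apply, smul_eq_mul]
  refine ENNReal.inv_mul_cancel ?_ (measure_ne_top _ _)
  rw [Ne, Measure.measure_univ_eq_zero]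
  exact Measure.toSphere_ne_zero _

/-- The mean length of the projection of `x` to a random hyperplane. -/
def meanProj {d : ℕ} (x : E d) : ENNReal := ∫⁻ v, ‖proj v x‖ₑ ∂uniformSphere d

lemma continuous_norm_proj {d : ℕ} (x : E d) : Continuous fun v : Sphere d => ‖proj v x‖ := by
  simp only [norm_proj]
  fun_prop

lemma measurable_enorm_proj {d : ℕ} (x : E d) : Measurable fun v : Sphere d => ‖proj v x‖ₑ := by
  simp only [← ofReal_norm]
  exact (continuous_norm_proj x).measurable.ennreal_ofReal

lemma meanProj_map {d : ℕ} (U : E d ≃ₗᵢ[ℝ] E d) (x : E d) : meanProj (U x) = meanProj x := by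
  rw [meanProj, ← (measurePreserving_sphereMap U).lintegral_comp (measurable_enorm_proj _)]
  refine lintegral_congr fun v => ?_
  rw [← ofReal_norm, ← ofReal_norm, norm_proj, norm_proj]
  congr 1
  have e : ((sphereMap U v : Sphere d) : E d) = U v := rfl
  rw [e, U.inner_map_map, ← map_smul, ← map_sub, U.norm_map]

/-- The reflection in the hyperplane orthogonal to `x - y` exchanges two vectors of equal norm. -/
lemma meanProj_congr {d : ℕ} {x y : E d} (h : ‖x‖ = ‖y‖) : meanProj x = meanProj y := by
  rw [← Submodule.reflection_sub h, meanProj_map]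

lemma meanProj_smul {d : ℕ} (t : ℝ) (x : E d) : meanProj (t • x) = ‖t‖ₑ * meanProj x := by
  simp only [meanProj, map_smul, enorm_smul]
  exact lintegral_const_mul _ (measurable_enorm_proj x)

lemma meanProj_eq {d : ℕ} {e : E d} (he : ‖e‖ = 1) (x : E d) :
    meanProj x = ‖x‖ₑ * meanProj e := by
  rw [meanProj_congr (y := ‖x‖ • e) (by simp [norm_smul, he]), meanProj_smul, enorm_norm]

/-- The `i`-th vector of the standard basis. -/
def stdVec {d : ℕ} (i : Fin d) : E d := EuclideanSpace.single i 1

lemma norm_stdVec {d : ℕ} (i : Fin d) : ‖stdVec i‖ = 1 := by simp [stdVec]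

lemma meanProj_ne_top {d : ℕ} (hd : 2 ≤ d) (x : E d) : meanProj x ≠ ⊤ := by
  have := isProbabilityMeasure_uniformSphere hd
  refine ne_top_of_le_ne_top (b := ‖x‖ₑ) enorm_ne_top ?_
  calc meanProj x ≤ ∫⁻ _ : Sphere d, ‖x‖ₑ ∂uniformSphere d := by
        refine lintegral_mono fun v => ?_
        rw [← ofReal_norm, ← ofReal_norm]
        exact ENNReal.ofReal_le_ofReal (norm_proj_le v x)
    _ = ‖x‖ₑ := by simp

/-- The squared lengths are `1 - v_i²` and `1 - v_j²`, with sum at least 1; lengths in `[0, 1]`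
dominate their squares. -/
lemma one_le_norm_proj_add {d : ℕ} {i j : Fin d} (h : i ≠ j) (v : Sphere d) :
    1 ≤ ‖proj v (stdVec i)‖ + ‖proj v (stdVec j)‖ := by
  have hi := norm_proj_sq v (stdVec i)
  have hj := norm_proj_sq v (stdVec j)
  have hi' := (norm_proj_le v (stdVec i))
  have hj' := (norm_proj_le v (stdVec j))
  rw [norm_stdVec] at hi hj hi' hj'
  have e (k : Fin d) : inner ℝ (v : E d) (stdVec k) = (v : E d) k := by
    rw [stdVec, EuclideanSpace.inner_single_right]
    simp
  rw [e] at hi hj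
  have hs : (v : E d) i ^ 2 + (v : E d) j ^ 2 ≤ 1 := by
    have h1 : ∑ k, (v : E d) k ^ 2 = 1 := by
      rw [← EuclideanSpace.real_norm_sq_eq, norm_sphere, one_pow]
    refine le_of_le_of_eq ?_ h1
    rw [← Finset.sum_pair (f := fun k => (v : E d) k ^ 2) h]
    exact Finset.sum_le_univ_sum_of_nonneg fun k => sq_nonneg _
  nlinarith [norm_nonneg (proj v (stdVec i)), norm_nonneg (proj v (stdVec j))]

/-- Two basis vectors have equal means with sum at least 1; this is where `d ≥ 2` enters. -/
lemma meanProj_stdVec_ne_zero {d : ℕ} (hd : 2 ≤ d) (i : Fin d) : meanProj (stdVec i) ≠ 0 := by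
  have := isProbabilityMeasure_uniformSphere hd
  have : Nontrivial (Fin d) := Fin.nontrivial_iff_two_le.2 hd
  obtain ⟨j, hj⟩ := exists_ne i
  intro h0
  have h1 : (1 : ENNReal) ≤ meanProj (stdVec i) + meanProj (stdVec j) := by
    rw [meanProj, meanProj, ← lintegral_add_left (measurable_enorm_proj _)]
    calc (1 : ENNReal) = ∫⁻ _ : Sphere d, 1 ∂uniformSphere d := by simp
      _ ≤ _ := lintegral_mono fun v => by
        rw [← ofReal_norm, ← ofReal_norm, ← ENNReal.ofReal_add (norm_nonneg _) (norm_nonneg _),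
          ← ENNReal.ofReal_one]
        exact ENNReal.ofReal_le_ofReal (one_le_norm_proj_add hj.symm v)
  rw [meanProj_congr (x := stdVec j) (y := stdVec i) (by simp [norm_stdVec]), h0] at h1
  simp at h1

/-! ### Intermediate values along a connected set. -/

/-- Along a connected set, a function cannot jump over a level except between neighbours. -/
lemma exists_crossing {d : ℕ} {A : Finset (Lattice d)} (hA : IsConnectedSet A)
    {x y : Lattice d} (hx : x ∈ A) (hy : y ∈ A) (g : Lattice d → ℝ) {t : ℝ}
    (hxt : g x ≤ t) (hyt : t ≤ g y) :
    ∃ a ∈ A, ∃ b ∈ A, ‖embed b - embed a‖ ≤ 1 ∧ g a ≤ t ∧ t ≤ g b := by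
  obtain ⟨p⟩ := hA.preconnected ⟨x, hx⟩ ⟨y, hy⟩
  have key : ∀ {a b : (A : Set (Lattice d))},
      ((latticeGraph d).induce (A : Set (Lattice d))).Walk a b → g a ≤ t → t ≤ g b →
      ∃ a ∈ A, ∃ b ∈ A, ‖embed b - embed a‖ ≤ 1 ∧ g a ≤ t ∧ t ≤ g b := by
    intro a b p
    induction p with
    -- A trivial walk forces `g a = t` and yields `b = a`, which is why the distance is only bounded
    -- by 1.
    | @nil a => exact fun h h' => ⟨a, a.2, a, a.2, by simp, h, h'⟩
    | @cons a b c h p ih =>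
      intro ha hc
      rcases le_total (g b) t with hb | hb
      · exact ih hb hc
      · refine ⟨a, a.2, b, b.2, ?_, ha, hb⟩
        rw [norm_sub_rev]
        exact le_of_eq h
  exact key p hxt hyt

lemma embed_add_mem_box {d : ℕ} (a : Lattice d) {w : E d} (hw : ∀ i, |w i| ≤ 1 / 2) :
    embed a + w ∈ box a := by
  intro i
  have := abs_le.1 (hw i)
  have e : (embed a + w) i = (a i : ℝ) + w i := rfl
  rw [e]
  constructor <;> linarith

lemma ball_subset_box {d : ℕ} (a : Lattice d) {w : E d} (hw : ‖w‖ ≤ 1 / 2) :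
    embed a + w ∈ box a :=
  embed_add_mem_box a fun i => (PiLp.norm_apply_le w i).trans hw

lemma mem_boxUnion {d : ℕ} {A : Finset (Lattice d)} {a : Lattice d} (ha : a ∈ A) {x : E d}
    (hx : x ∈ box a) : x ∈ boxUnion A := Set.mem_biUnion ha hx

/-- Each half of the segment stays within distance 1/2 of its own endpoint, hence in that endpoint's
box. -/
lemma segment_subset_boxUnion {d : ℕ} {A : Finset (Lattice d)} {a b : Lattice d} (ha : a ∈ A)
    (hb : b ∈ A) (h : ‖embed b - embed a‖ ≤ 1) {s : ℝ} (hs : s ∈ Set.Icc (0 : ℝ) 1) :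
    embed a + s • (embed b - embed a) ∈ boxUnion A := by
  rcases le_total s (1 / 2) with h' | h'
  · refine mem_boxUnion ha (ball_subset_box a ?_)
    rw [norm_smul, Real.norm_of_nonneg hs.1]
    nlinarith [norm_nonneg (embed b - embed a)]
  · have e : embed a + s • (embed b - embed a) = embed b + (s - 1) • (embed b - embed a) := by
      module
    rw [e]
    refine mem_boxUnion hb (ball_subset_box b ?_)
    rw [norm_smul, Real.norm_eq_abs, abs_of_nonpos (by linarith [hs.2])]
    nlinarith [norm_nonneg (embed b - embed a)]

lemma exists_mem_boxUnion {d : ℕ} {A : Finset (Lattice d)} (hA : IsConnectedSet A)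
    {x y : Lattice d} (hx : x ∈ A) (hy : y ∈ A) (f : E d →L[ℝ] ℝ) {t : ℝ}
    (hxt : f (embed x) ≤ t) (hyt : t ≤ f (embed y)) : ∃ q ∈ boxUnion A, f q = t := by
  obtain ⟨a, ha, b, hb, hab, h1, h2⟩ := exists_crossing hA hx hy (fun z => f (embed z)) hxt hyt
  obtain ⟨s, hs, he⟩ := intermediate_value_Icc (zero_le_one' ℝ)
    (f := fun s : ℝ => f (embed a + s • (embed b - embed a))) (by fun_prop)
    (show t ∈ Set.Icc _ _ from ⟨by simpa using h1, by simpa using h2⟩)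
  exact ⟨_, segment_subset_boxUnion ha hb hab hs, he⟩

/-! ### Volumes of balls in the hyperplanes. -/

lemma finrank_perp {n : ℕ} (v : Sphere (n + 1)) : Module.finrank ℝ (Perp v) = n := by
  have : Fact (Module.finrank ℝ (E (n + 1)) = n + 1) := ⟨by simp⟩
  exact Submodule.finrank_orthogonal_span_singleton (ne_zero_of_mem_unit_sphere v)

lemma nontrivial_perp {n : ℕ} (hn : n ≠ 0) (v : Sphere (n + 1)) : Nontrivial (Perp v) :=
  Module.nontrivial_of_finrank_pos (R := ℝ) (by rw [finrank_perp]; omega)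

/-- The volume of the unit ball of `ℝ^n`, in the closed form. -/
def unitBallVolume (n : ℕ) : ℝ := √Real.pi ^ n / Real.Gamma (n / 2 + 1)

lemma unitBallVolume_pos (n : ℕ) : 0 < unitBallVolume n :=
  div_pos (pow_pos (Real.sqrt_pos.2 Real.pi_pos) n) (Real.Gamma_pos_of_pos (by positivity))

lemma unitBallVolume_one : unitBallVolume 1 = 2 := by
  have := Real.sqrt_pos.2 Real.pi_pos
  rw [unitBallVolume, Nat.cast_one, Real.Gamma_add_one (by norm_num), Real.Gamma_one_half_eq]
  field_simp

/-- The closed form shows that the volume is the same for all `v`, although the spaces `Perp v`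
differ. -/
lemma volume_ball_perp {n : ℕ} (hn : n ≠ 0) (v : Sphere (n + 1)) (x : Perp v) (ρ : ℝ) :
    volume (Metric.ball x ρ) = ENNReal.ofReal ρ ^ n * ENNReal.ofReal (unitBallVolume n) := by
  have := nontrivial_perp hn v
  rw [InnerProductSpace.volume_ball, finrank_perp]
  rfl

lemma volume_closedBall_perp {n : ℕ} (hn : n ≠ 0) (v : Sphere (n + 1)) (x : Perp v) (ρ : ℝ) :
    volume (Metric.closedBall x ρ) =
      ENNReal.ofReal ρ ^ n * ENNReal.ofReal (unitBallVolume n) := by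
  have := nontrivial_perp hn v
  rw [← volume_ball_perp hn v x, Measure.addHaar_closedBall_eq_addHaar_ball]

lemma proj_coe {d : ℕ} (v : Sphere d) (x : Perp v) : proj v (x : E d) = x :=
  Submodule.orthogonalProjectionOnto_mem_subspace_eq_self x

/-! ### Upper bounds for the projection of a box. -/

lemma volume_proj_box_le {n : ℕ} (hn : n ≠ 0) (v : Sphere (n + 1)) (z : Lattice (n + 1)) :
    volume (proj v '' box z) ≤
      ENNReal.ofReal (√(n + 1 : ℕ) / 2) ^ n * ENNReal.ofReal (unitBallVolume n) := by
  rw [← volume_closedBall_perp hn v (proj v (embed z))]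
  refine measure_mono ?_
  rintro _ ⟨x, hx, rfl⟩
  rw [Metric.mem_closedBall, dist_eq_norm, ← map_sub]
  exact (norm_proj_le v _).trans (norm_sub_embed_le hx)

lemma volume_closedBall_perp_two (v : Sphere 2) (x : Perp v) (ρ : ℝ) :
    volume (Metric.closedBall x ρ) = ENNReal.ofReal (2 * ρ) := by
  rw [volume_closedBall_perp one_ne_zero, unitBallVolume_one, pow_one, mul_comm,
    ENNReal.ofReal_mul two_pos.le]

/-- The bound keeps its dependence on `v`: its mean is `2 m`, and this `m` later cancels exactly. -/
lemma volume_proj_box_le_two (v : Sphere 2) (z : Lattice 2) :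
    volume (proj v '' box z) ≤ ‖proj v (stdVec 0)‖ₑ + ‖proj v (stdVec 1)‖ₑ := by
  rw [← ofReal_norm, ← ofReal_norm, ← ENNReal.ofReal_add (norm_nonneg _) (norm_nonneg _),
    ← mul_div_cancel₀ (‖proj v (stdVec 0)‖ + ‖proj v (stdVec 1)‖) (two_ne_zero (α := ℝ)),
    ← volume_closedBall_perp_two v (proj v (embed z))]
  refine measure_mono ?_
  rintro _ ⟨x, hx, rfl⟩
  have hw (i : Fin 2) : ‖(x - embed z) i‖ ≤ 1 / 2 := by
    have := hx i
    have e : (x - embed z) i = x i - (z i : ℝ) := rfl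
    rw [e, Real.norm_eq_abs, abs_le]
    constructor <;> linarith [this.1, this.2]
  have hd : x - embed z = (x - embed z) 0 • stdVec 0 + (x - embed z) 1 • stdVec 1 := by
    ext i
    fin_cases i <;> simp [stdVec]
  rw [Metric.mem_closedBall, dist_eq_norm, ← map_sub, hd, map_add, map_smul, map_smul]
  refine (norm_add_le _ _).trans ?_
  rw [norm_smul, norm_smul]
  nlinarith [hw 0, hw 1, norm_nonneg (proj v (stdVec 0)), norm_nonneg (proj v (stdVec 1))]

/-! ### Lower bounds for the projection of `□A`. -/

lemma embed_zero {d : ℕ} : embed (0 : Lattice d) = 0 := by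
  ext i
  simp [embed]

lemma enorm_proj_le_volume_two {A : Finset (Lattice 2)} (hA : IsConnectedSet A) (h0 : 0 ∈ A)
    {x : Lattice 2} (hx : x ∈ A) (v : Sphere 2) :
    ‖proj v (embed x)‖ₑ ≤ volume (proj v '' boxUnion A) := by
  set p := proj v (embed x) with hp
  by_cases hp0 : p = 0
  · simp [hp0]
  have hpos : 0 < ‖p‖ := norm_pos_iff.2 hp0
  -- On the line `v^⊥`, the ball of radius `‖p‖ / 2` about `p / 2` is the segment from `0` to `p`.
  rw [← ofReal_norm, ← mul_div_cancel₀ ‖p‖ (two_ne_zero (α := ℝ)),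
    ← volume_closedBall_perp_two v ((1 / 2 : ℝ) • p)]
  refine measure_mono fun y hy => ?_
  obtain ⟨s, rfl⟩ := (finrank_eq_one_iff_of_nonzero' p hp0).1 (finrank_perp v) y
  rw [Metric.mem_closedBall, dist_eq_norm, ← sub_smul, norm_smul, Real.norm_eq_abs] at hy
  have hs : |s - 1 / 2| ≤ 1 / 2 := by
    by_contra! h
    nlinarith
  have hs' := abs_le.1 hs
  -- Pairing with `p` sends `s • p` to `s * ‖p‖ ^ 2`, so this level singles out the point `s • p` of
  -- the line.
  obtain ⟨q, hq, he⟩ := exists_mem_boxUnion hA h0 hx ((innerSL ℝ p).comp (proj v))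
    (t := s * ‖p‖ ^ 2) (by
      rw [embed_zero, map_zero]
      have : 0 ≤ s := by linarith
      positivity) (by
      rw [ContinuousLinearMap.comp_apply, ← hp, innerSL_apply_apply, real_inner_self_eq_norm_sq]
      nlinarith [sq_nonneg ‖p‖])
  refine ⟨q, hq, ?_⟩
  obtain ⟨t, ht⟩ := (finrank_eq_one_iff_of_nonzero' p hp0).1 (finrank_perp v) (proj v q)
  rw [ContinuousLinearMap.comp_apply, innerSL_apply_apply, ← ht, inner_smul_right,
    real_inner_self_eq_norm_sq] at he
  rw [← ht, mul_right_cancel₀ (pow_pos hpos 2).ne' he]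

lemma ball_subset_proj_boxUnion {d : ℕ} {A : Finset (Lattice d)} {z : Lattice d} (hz : z ∈ A)
    (v : Sphere d) : Metric.ball (proj v (embed z)) (1 / 2) ⊆ proj v '' boxUnion A := by
  intro y hy
  rw [Metric.mem_ball, dist_eq_norm] at hy
  refine ⟨embed z + ((y - proj v (embed z) : Perp v) : E d),
    mem_boxUnion hz (ball_subset_box z hy.le), ?_⟩
  rw [map_add, proj_coe]
  abel

/-- Measure heights along `p`. Points of `A` at heights in `[2j, 2j + 1]`, for `0 ≤ j ≤ ‖p‖ / 2`,
carry disjoint balls of radius 1/2 inside the projection. There are at least `‖p‖ / 2` of them,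
which accounts for the extra factor 1/2 in the exponent `n + 1`. -/
lemma enorm_proj_le_volume {n : ℕ} (hn : n ≠ 0) {A : Finset (Lattice (n + 1))}
    (hA : IsConnectedSet A) (h0 : 0 ∈ A) {x : Lattice (n + 1)} (hx : x ∈ A)
    (v : Sphere (n + 1)) :
    ‖proj v (embed x)‖ₑ * (ENNReal.ofReal (1 / 2) ^ (n + 1) * ENNReal.ofReal (unitBallVolume n)) ≤
      volume (proj v '' boxUnion A) := by
  set p := proj v (embed x) with hp
  by_cases hp0 : p = 0
  · simp [hp0]
  have hpos : 0 < ‖p‖ := norm_pos_iff.2 hp0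
  set u : Perp v := ‖p‖⁻¹ • p with hu
  have hu1 : ‖u‖ = 1 := by
    rw [hu, norm_smul, norm_inv, norm_norm, inv_mul_cancel₀ hpos.ne']
  have hup : inner ℝ u p = ‖p‖ := by
    rw [hu, real_inner_smul_left, real_inner_self_eq_norm_sq]
    field_simp
  have hlip (a b : Lattice (n + 1)) :
      |inner ℝ u (proj v (embed a)) - inner ℝ u (proj v (embed b))| ≤
        dist (proj v (embed a)) (proj v (embed b)) := by
    rw [← inner_sub_right, dist_eq_norm]
    simpa [hu1] using abs_real_inner_le_norm u (proj v (embed a) - proj v (embed b))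
  -- The indices `j < N` are exactly those with `2 * j ≤ ‖p‖`.
  set N := ⌊‖p‖ / 2⌋₊ + 1 with hN
  have hz : ∀ j ∈ Finset.range N, ∃ z ∈ A,
      inner ℝ u (proj v (embed z)) ∈ Set.Icc (2 * (j : ℝ)) (2 * j + 1) := by
    intro j hj
    have hj' : (j : ℝ) ≤ ‖p‖ / 2 :=
      (Nat.le_floor_iff (by positivity)).1 (by rw [Finset.mem_range] at hj; omega)
    obtain ⟨a, ha, b, hb, hab, h1, h2⟩ := exists_crossing hA h0 hx
      (fun z => inner ℝ u (proj v (embed z))) (t := 2 * (j : ℝ))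
      (by simp [embed_zero]) (by rw [← hp, hup]; linarith)
    refine ⟨b, hb, h2, ?_⟩
    -- A lattice step has length at most 1 and projecting does not lengthen it, so `b` overshoots
    -- the level by at most 1.
    have h3 := (le_abs_self _).trans (hlip b a)
    rw [dist_eq_norm, ← map_sub] at h3
    linarith [norm_proj_le v (embed b - embed a)]
  choose! z hzA hz using hz
  have hdisj : Set.PairwiseDisjoint (Finset.range N : Set ℕ)
      fun j => Metric.ball (proj v (embed (z j))) (1 / 2) := by
    have key : ∀ i ∈ Finset.range N, ∀ j ∈ Finset.range N, i < j →
        1 ≤ dist (proj v (embed (z i))) (proj v (embed (z j))) := by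
      intro i hi j hj hij
      have h1 := (hz i hi).2
      have h2 := (hz j hj).1
      have h3 := (neg_le_abs _).trans (hlip (z i) (z j))
      -- Heights at most `2i + 1` and at least `2j ≥ 2i + 2` leave a gap of 1, the sum of the two
      -- radii.
      have h4 : (i : ℝ) + 1 ≤ j := by exact_mod_cast hij
      linarith
    intro i hi j hj hij
    refine Metric.ball_disjoint_ball ?_
    rw [add_halves]
    rcases hij.lt_or_gt with h | h
    · exact key i hi j hj h
    · rw [dist_comm]
      exact key j hj i hi h
  have hN' : ‖p‖ / 2 ≤ N := by
    rw [hN]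
    push_cast
    exact (Nat.lt_floor_add_one _).le
  calc ‖p‖ₑ * (ENNReal.ofReal (1 / 2) ^ (n + 1) * ENNReal.ofReal (unitBallVolume n))
      = ENNReal.ofReal (‖p‖ / 2) *
          (ENNReal.ofReal (1 / 2) ^ n * ENNReal.ofReal (unitBallVolume n)) := by
        rw [div_eq_mul_one_div ‖p‖, ENNReal.ofReal_mul hpos.le, ofReal_norm, pow_succ]
        ring
    _ ≤ N * (ENNReal.ofReal (1 / 2) ^ n * ENNReal.ofReal (unitBallVolume n)) := by
        gcongr
        exact ENNReal.ofReal_le_of_le_toReal (by simpa using hN')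
    _ = ∑ j ∈ Finset.range N, volume (Metric.ball (proj v (embed (z j))) (1 / 2)) := by
        simp only [volume_ball_perp hn, Finset.sum_const, Finset.card_range, nsmul_eq_mul]
    _ = volume (⋃ j ∈ Finset.range N, Metric.ball (proj v (embed (z j))) (1 / 2)) :=
        (measure_biUnion_finset hdisj fun _ _ => measurableSet_ball).symm
    _ ≤ volume (proj v '' boxUnion A) :=
        measure_mono (Set.iUnion₂_subset fun j hj => ball_subset_proj_boxUnion (hzA j hj) v)

/-! ### Comparing numerator and denominator. -/

lemma exists_rad_le {d : ℕ} {A : Finset (Lattice d)} (h0 : 0 ∈ A) {r : ℝ} (hr : r ≤ rad A) :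
    ∃ x ∈ A, r ≤ ‖embed x‖ := by
  obtain ⟨x, hx, he⟩ := A.exists_mem_eq_sup ⟨0, h0⟩ fun z => ‖embed z‖₊
  refine ⟨x, hx, ?_⟩
  rw [rad, he] at hr
  exact hr

lemma ballisticMass_le_two (v : Line 2 → Sphere 2) {r : ℝ} (hr : 0 < r) {A : Finset (Lattice 2)}
    (hA : IsConnectedSet A) (h0 : 0 ∈ A) (hrad : r ≤ rad A) (z : Lattice 2) :
    ballisticMass v A z ≤ ENNReal.ofReal (2 * r⁻¹) := by
  obtain ⟨x, hx, hrx⟩ := exists_rad_le h0 hrad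
  refine (ballisticMass_le v A z).trans ?_
  set m := meanProj (stdVec (0 : Fin 2)) with hm
  have hm0 : m ≠ 0 := meanProj_stdVec_ne_zero le_rfl 0
  have hmt : m ≠ ⊤ := meanProj_ne_top le_rfl _
  have h1 : lineMeasure 2 (hit (box z)) ≤ 2 * m := by
    rw [lineMeasure_hit (measurableSet_hit_box z), two_mul]
    refine (lintegral_mono fun v => volume_proj_box_le_two v z).trans ?_
    rw [lintegral_add_left (measurable_enorm_proj _)]
    exact le_of_eq (congrArg (m + ·) (meanProj_congr (by rw [norm_stdVec, norm_stdVec])))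
  have h2 : ENNReal.ofReal r * m ≤ lineMeasure 2 (hit (boxUnion A)) := by
    rw [lineMeasure_hit (measurableSet_hit_boxUnion A)]
    calc ENNReal.ofReal r * m ≤ ‖embed x‖ₑ * m := by
          rw [← ofReal_norm]
          gcongr
      _ = meanProj (embed x) := (meanProj_eq (norm_stdVec 0) _).symm
      _ ≤ _ := lintegral_mono fun v => enorm_proj_le_volume_two hA h0 hx v
  calc _ ≤ 2 * m / (ENNReal.ofReal r * m) := ENNReal.div_le_div h1 h2
    _ = 2 / ENNReal.ofReal r := ENNReal.mul_div_mul_right _ _ hm0 hmt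
    _ = _ := by
      rw [← div_eq_mul_inv, ENNReal.ofReal_div_of_pos hr, ENNReal.ofReal_ofNat]

lemma exists_ballisticMass_le {d : ℕ} (hd : 2 ≤ d) :
    ∃ C : ℝ, 0 < C ∧ ∀ (v : Line d → Sphere d) (r : ℝ), 0 < r → ∀ A : Finset (Lattice d),
      IsConnectedSet A → 0 ∈ A → r ≤ rad A → ∀ z : Lattice d,
        ballisticMass v A z ≤ ENNReal.ofReal (C * r⁻¹) := by
  obtain ⟨n, rfl⟩ : ∃ n, d = n + 1 := ⟨d - 1, by omega⟩
  have hn : n ≠ 0 := by omega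
  have := isProbabilityMeasure_uniformSphere hd
  set m := meanProj (stdVec (0 : Fin (n + 1)))
  have hm0 : m ≠ 0 := meanProj_stdVec_ne_zero hd 0
  have hmt : m ≠ ⊤ := meanProj_ne_top hd _
  have hκ : ENNReal.ofReal (unitBallVolume n) ≠ 0 := by
    simpa using unitBallVolume_pos n
  set a := ENNReal.ofReal (√(n + 1 : ℕ) / 2) ^ n * ENNReal.ofReal (unitBallVolume n) with ha
  set b := m * (ENNReal.ofReal (1 / 2) ^ (n + 1) * ENNReal.ofReal (unitBallVolume n)) with hb
  have ha0 : a ≠ 0 := mul_ne_zero (pow_ne_zero _ (by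
    rw [Ne, ENNReal.ofReal_eq_zero, not_le]; positivity)) hκ
  have hat : a ≠ ⊤ := ENNReal.mul_ne_top (ENNReal.pow_ne_top ENNReal.ofReal_ne_top)
    ENNReal.ofReal_ne_top
  have hb0 : b ≠ 0 := mul_ne_zero hm0 (mul_ne_zero (pow_ne_zero _ (by
    rw [Ne, ENNReal.ofReal_eq_zero, not_le]; positivity)) hκ)
  have hbt : b ≠ ⊤ := ENNReal.mul_ne_top hmt (ENNReal.mul_ne_top
    (ENNReal.pow_ne_top ENNReal.ofReal_ne_top) ENNReal.ofReal_ne_top)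
  have hab0 : a / b ≠ 0 := ENNReal.div_ne_zero.2 ⟨ha0, hbt⟩
  have habt : a / b ≠ ⊤ := ENNReal.div_ne_top hat hb0
  -- Here `a` bounds `μ₁[C_z]` from above and `b * r` bounds `μ₁[□A]` from below.
  refine ⟨(a / b).toReal, ENNReal.toReal_pos hab0 habt, fun v r hr A hA h0 hrad z => ?_⟩
  obtain ⟨x, hx, hrx⟩ := exists_rad_le h0 hrad
  refine (ballisticMass_le v A z).trans ?_
  have h1 : lineMeasure (n + 1) (hit (box z)) ≤ a := by
    rw [lineMeasure_hit (measurableSet_hit_box z)]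
    exact (lintegral_mono fun v => volume_proj_box_le hn v z).trans_eq
      (by rw [lintegral_const, measure_univ, mul_one])
  have h2 : b * ENNReal.ofReal r ≤ lineMeasure (n + 1) (hit (boxUnion A)) := by
    rw [lineMeasure_hit (measurableSet_hit_boxUnion A)]
    refine le_trans ?_ (lintegral_mono fun v => enorm_proj_le_volume hn hA h0 hx v)
    rw [lintegral_mul_const _ (measurable_enorm_proj _), ← meanProj,
      meanProj_eq (norm_stdVec 0), hb, mul_comm, ← mul_assoc, ← ofReal_norm]
    gcongr
  calc _ ≤ a / (b * ENNReal.ofReal r) := ENNReal.div_le_div h1 h2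
    _ = a / b * (ENNReal.ofReal r)⁻¹ := by
      rw [div_eq_mul_inv, ENNReal.mul_inv (Or.inl hb0) (Or.inl hbt), ← mul_assoc,
        div_eq_mul_inv a b]
    _ = _ := by
      rw [ENNReal.ofReal_mul ENNReal.toReal_nonneg, ENNReal.ofReal_toReal habt,
        ENNReal.ofReal_inv_of_pos hr]

end Ballistic

end

theorem mainTheorem4 :
    ∃ C : ℕ → ℝ, C 2 = 2 ∧ ∀ d : ℕ, 2 ≤ d → 0 < C d ∧
      ∀ v : Ballistic.Line d → Ballistic.Sphere d, Ballistic.IsDirectionChoice v →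
      ∀ r : ℝ, 1 ≤ r →
      ∀ A : Finset (Ballistic.Lattice d), Ballistic.IsConnectedSet A → 0 ∈ A →
        r ≤ Ballistic.rad A →
      ∀ z ∈ A, Ballistic.ballisticMass v A z ≤ ENNReal.ofReal (C d * r⁻¹) := by
  -- One function of `d` is needed: its value is 2 in the plane, the general constant above, and an
  -- irrelevant 0 for `d < 2`.
  have h (d : ℕ) : ∃ C : ℝ, (d = 2 → C = 2) ∧ (2 ≤ d → 0 < C ∧
      ∀ (v : Ballistic.Line d → Ballistic.Sphere d) (r : ℝ), 0 < r →
      ∀ A : Finset (Ballistic.Lattice d), Ballistic.IsConnectedSet A → 0 ∈ A →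
        r ≤ Ballistic.rad A → ∀ z : Ballistic.Lattice d,
        Ballistic.ballisticMass v A z ≤ ENNReal.ofReal (C * r⁻¹)) := by
    by_cases hd : d = 2
    · subst hd
      exact ⟨2, fun _ => rfl, fun _ => ⟨two_pos, fun v r hr A hA h0 hrad z =>
        Ballistic.ballisticMass_le_two v hr hA h0 hrad z⟩⟩
    · by_cases hd' : 2 ≤ d
      · obtain ⟨C, hC⟩ := Ballistic.exists_ballisticMass_le hd'
        exact ⟨C, fun h => absurd h hd, fun _ => hC⟩
      · exact ⟨0, fun h => absurd h hd, fun h => absurd h hd'⟩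
  choose C hC using h
  refine ⟨C, (hC 2).1 rfl, fun d hd => ⟨((hC d).2 hd).1, ?_⟩⟩
  intro v _ r hr A hA h0 hrad z _
  exact ((hC d).2 hd).2 v r (one_pos.trans_le hr) A hA h0 hrad z
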